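/- Let $d\ge 1$, $k\ge 0$ and $N$ be integers and let $\epsilon>0$. Let $\mathcal E=\{p_i,U_i\}_{i=1}^N$ be a finite ensemble of unitaries $U_i\in U(d)$ with probabilities $p_i\ge 0$, $\sum_{i=1}^N p_i=1$, and let $$\mathcal T^{(k)}_{\mathcal E}(X)=\sum_{i=1}^N p_i\,U_i^{\otimes k}X(U_i^\dagger)^{\otimes k},\qquad \mathcal T^{(k)}_{U}(X)=\int_{U(d)}U^{\otimes k}X(U^\dagger)^{\otimes k}\,\mathrm dU$$ be the $k$-fold twirling channels, for $X$ acting on $(\mathbb C^d)^{\otimes k}$, of $\mathcal E$ and of the normalized Haar measure on $U(d)$. Suppose that $\mathcal E$ is an $\epsilon$-approximate unitary $k$-design, that is, $$\bigl\|\mathcal T^{(k)}_{\mathcal E}-\mathcal T^{(k)}_{U}\bigr\|_\diamond\le\frac{k!}{d^{2k}}\,\epsilon .$$ Here, for channels $\mathcal A,\mathcal B$ on operators on a finite-dimensional Hilbert space $H$, $\|\mathcal A-\mathcal B\|_\diamond=\max_{\psi}\bigl\|((\mathcal A-\mathcal B)\otimes\mathcal I)(|\psi\rangle\langle\psi|)\bigr\|_1$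 is the diamond norm; the maximum is over unit vectors $\psi\in H\otimes H$, $\mathcal I$ is the identity map and $\|\cdot\|_1$ is the trace norm. Then $$\max_{1\le j\le N}p_j\le(1+\epsilon)\,\frac{k!}{d^{2k}}\qquad\text{and}\qquad N\ge\frac{d^{2k}}{(1+\epsilon)\,k!}.$$ -/

import Mathlib

open MeasureTheory
open scoped Matrix

noncomputable section

namespace UnitaryDesign

/-! ### Trace norm and diamond norm -/

/-- The trace norm `‖X‖₁ = Tr √(Xᴴ X)`: the sum of the singular values of `X`, that is, of the square
roots of the eigenvalues (with multiplicity) of `Xᴴ X`. -/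
def traceNorm {n : Type*} [Fintype n] [DecidableEq n] (X : Matrix n n ℂ) : ℝ :=
  ∑ i, √((Matrix.isHermitian_conjTranspose_mul_self X).eigenvalues i)

/-- `(Φ ⊗ 𝓘)(X)`: the map `Φ` acts on the first tensor factor, the identity map on the second
factor (the memory). -/
def tensorId {n : Type*} (m : Type*) (Φ : Matrix n n ℂ →ₗ[ℂ] Matrix n n ℂ)
    (X : Matrix (n × m) (n × m) ℂ) : Matrix (n × m) (n × m) ℂ :=
  Matrix.of fun a b => Φ (Matrix.of fun i j => X (i, a.2) (j, b.2)) a.1 b.1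

/-- The rank-one projector `|ψ⟩⟨ψ|`. -/
def ketbra {n : Type*} (ψ : EuclideanSpace ℂ n) : Matrix n n ℂ :=
  Matrix.of fun i j => ψ i * star (ψ j)

/-- The diamond norm `‖Φ‖_⋄` of a difference `Φ = 𝓐 - 𝓑` of two channels (more generally, of a
Hermiticity-preserving map): the supremum of `‖(Φ ⊗ 𝓘)(|ψ⟩⟨ψ|)‖₁` over all unit vectors
`ψ ∈ ℂⁿ ⊗ ℂⁿ`. By convexity, mixed input states give the same value. -/
def diamondNorm {n : Type*} [Fintype n] [DecidableEq n]
    (Φ : Matrix n n ℂ →ₗ[ℂ] Matrix n n ℂ) : ℝ :=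
  ⨆ ψ : {ψ : EuclideanSpace ℂ (n × n) // ‖ψ‖ = 1}, traceNorm (tensorId n Φ (ketbra ψ.1))

/-! ### Haar measure on the unitary group -/

/-- The Borel σ-algebra of `U(d)` (with the topology of entrywise convergence). -/
instance instMeasurableSpaceUnitary (d : ℕ) :
    MeasurableSpace (Matrix.unitaryGroup (Fin d) ℂ) := borel _

instance instBorelSpaceUnitary (d : ℕ) : BorelSpace (Matrix.unitaryGroup (Fin d) ℂ) := ⟨rfl⟩

instance instCompactSpaceUnitary (d : ℕ) : CompactSpace (Matrix.unitaryGroup (Fin d) ℂ) := by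
  have hc : IsCompact {A : Matrix (Fin d) (Fin d) ℂ | ∀ i j, A i j ∈ Metric.closedBall (0 : ℂ) 1} :=
    isCompact_pi_infinite fun _ => isCompact_pi_infinite fun _ => isCompact_closedBall _ _
  refine (isCompact_iff_compactSpace
    (s := (Matrix.unitaryGroup (Fin d) ℂ : Set (Matrix (Fin d) (Fin d) ℂ)))).mp
    (hc.of_isClosed_subset isClosed_unitary ?_)
  intro A hA i j
  simpa using entry_norm_bound_of_unitary hA i j

/-- The Haar measure on `U(d)`, normalized to total mass one. -/
def haar (d : ℕ) : Measure (Matrix.unitaryGroup (Fin d) ℂ) := Measure.haarMeasure ⊤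

instance instIsHaarMeasureHaar (d : ℕ) : (haar d).IsHaarMeasure :=
  inferInstanceAs (Measure.haarMeasure ⊤).IsHaarMeasure

instance instIsProbabilityMeasureHaar (d : ℕ) : IsProbabilityMeasure (haar d) :=
  ⟨Measure.haarMeasure_self⟩

/-! ### Twirling channels -/

/-- The `k`-fold tensor power `A^{⊗k}` acting on `(ℂᵈ)^{⊗k}`, in the product basis, which is indexed
by `Fin k → Fin d`. -/
def tensorPower {d : ℕ} (k : ℕ) (A : Matrix (Fin d) (Fin d) ℂ) :
    Matrix (Fin k → Fin d) (Fin k → Fin d) ℂ :=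
  Matrix.of fun a b => ∏ s, A (a s) (b s)

/-- `X ↦ U^{⊗k} X (U†)^{⊗k}`. -/
def conjChannel {d : ℕ} (k : ℕ) (U : Matrix.unitaryGroup (Fin d) ℂ) :
    Matrix (Fin k → Fin d) (Fin k → Fin d) ℂ →ₗ[ℂ] Matrix (Fin k → Fin d) (Fin k → Fin d) ℂ where
  toFun X := tensorPower k U.1 * X * tensorPower k U.1ᴴ
  map_add' X Y := by rw [mul_add, add_mul]
  map_smul' c X := by simp

theorem continuous_conjChannel_apply {d : ℕ} (k : ℕ)
    (X : Matrix (Fin k → Fin d) (Fin k → Fin d) ℂ) (a b : Fin k → Fin d) :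
    Continuous fun U : Matrix.unitaryGroup (Fin d) ℂ => conjChannel k U X a b := by
  have h : ∀ i j, Continuous fun U : Matrix.unitaryGroup (Fin d) ℂ => U.1 i j := fun i j =>
    (continuous_apply j).comp ((continuous_apply i).comp continuous_subtype_val)
  simp only [conjChannel, tensorPower, LinearMap.coe_mk, AddHom.coe_mk, Matrix.mul_apply,
    Matrix.of_apply, Matrix.conjTranspose_apply]
  exact continuous_finsetSum _ fun j _ =>
    ((continuous_finsetSum _ fun l _ =>
      (continuous_finsetProd _ fun s _ => h (a s) (l s)).mul continuous_const).mul
      (continuous_finsetProd _ fun s _ => (h (b s) (j s)).star))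

theorem integrable_conjChannel_apply {d : ℕ} (k : ℕ)
    (X : Matrix (Fin k → Fin d) (Fin k → Fin d) ℂ) (a b : Fin k → Fin d) :
    Integrable (fun U => conjChannel k U X a b) (haar d) :=
  (continuous_conjChannel_apply k X a b).integrable_of_hasCompactSupport
    (HasCompactSupport.of_compactSpace _)

/-- The Haar twirl `𝓣_U^{(k)}(X) = ∫ U^{⊗k} X (U†)^{⊗k} dU` over `U(d)`; the matrix-valued integral is
taken entrywise. -/
def haarTwirl (d k : ℕ) :
    Matrix (Fin k → Fin d) (Fin k → Fin d) ℂ →ₗ[ℂ] Matrix (Fin k → Fin d) (Fin k → Fin d) ℂ where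
  toFun X := Matrix.of fun a b => ∫ U, conjChannel k U X a b ∂(haar d)
  map_add' X Y := by
    ext a b
    simp only [map_add, Matrix.add_apply, Matrix.of_apply]
    exact integral_add (integrable_conjChannel_apply k X a b) (integrable_conjChannel_apply k Y a b)
  map_smul' c X := by
    ext a b
    simp only [map_smul, Matrix.smul_apply, Matrix.of_apply, RingHom.id_apply]
    exact integral_smul c _

/-- A finite ensemble `{pᵢ, Uᵢ}_{i = 1, …, N}` of `d × d` unitaries: `Uᵢ` occurs with probability
`pᵢ`. -/
structure Ensemble (d N : ℕ) where
  /-- the weights -/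
  p : Fin N → ℝ
  /-- the unitaries -/
  U : Fin N → Matrix.unitaryGroup (Fin d) ℂ
  p_nonneg : ∀ i, 0 ≤ p i
  sum_p : ∑ i, p i = 1

/-- The twirling channel `𝓣_𝓔^{(k)}(X) = ∑ᵢ pᵢ Uᵢ^{⊗k} X (Uᵢ†)^{⊗k}` of an ensemble. -/
def Ensemble.twirl {d N : ℕ} (E : Ensemble d N) (k : ℕ) :
    Matrix (Fin k → Fin d) (Fin k → Fin d) ℂ →ₗ[ℂ] Matrix (Fin k → Fin d) (Fin k → Fin d) ℂ :=
  ∑ i, (E.p i : ℂ) • conjChannel k (E.U i)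

/-- `𝓔` is an `ε`-approximate unitary `k`-design:
`‖𝓣_𝓔^{(k)} - 𝓣_U^{(k)}‖_⋄ ≤ (k! / d^{2k}) ε`. -/
def Ensemble.IsApproxDesign {d N : ℕ} (E : Ensemble d N) (k : ℕ) (ε : ℝ) : Prop :=
  diamondNorm (E.twirl k - haarTwirl d k) ≤ (k.factorial : ℝ) / (d : ℝ) ^ (2 * k) * ε

end UnitaryDesign

end

open MeasureTheory
open scoped Matrix

noncomputable section

namespace UnitaryDesign

variable {d k : ℕ}

/-! Fix `j`, put `V = U_j^{⊗k}`, and feed half of a maximally entangled state into the difference of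
the two twirls. The overlap of the output with the maximally entangled vector of `V` is at most its
trace norm, hence at most the diamond norm. This overlap is `d^{-2k}` times the trace of the
superoperator `X ↦ V† Δ(X) V` (`dotProduct_tensorId_maxEntangled`). The ensemble contributes at
least `p_j d^{2k}` to the trace, since all other terms are nonnegative. The Haar twirl projects onto
the commutant of the `U^{⊗k}`, so it contributes the dimension of that commutant, and
`finrank_commutant_le` bounds it by `k!`.

The dimension bound needs only part of Schur-Weyl duality. Elements of the commutant commute with
`A^{⊗k}` for every matrix `A`, hence, by polarization, with symmetrized matrix units. It follows
that they are determined by their `k!` pairings with permutation operators. -/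

theorem tensorPower_mul (A B : Matrix (Fin d) (Fin d) ℂ) :
    tensorPower k (A * B) = tensorPower k A * tensorPower k B := by
  ext a b
  simp only [tensorPower, Matrix.of_apply, Matrix.mul_apply, Finset.prod_univ_sum,
    Fintype.piFinset_univ, Finset.prod_mul_distrib]

theorem tensorPower_one : tensorPower k (1 : Matrix (Fin d) (Fin d) ℂ) = 1 := by
  ext a b
  simp only [tensorPower, Matrix.of_apply, Matrix.one_apply, Finset.prod_ite_zero,
    Finset.prod_const_one, Finset.mem_univ, true_implies, funext_iff]

theorem tensorPower_conjTranspose (A : Matrix (Fin d) (Fin d) ℂ) :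
    tensorPower k Aᴴ = (tensorPower k A)ᴴ := by
  ext a b
  simp [tensorPower]

theorem tensorPower_diagonal (z : Fin d → ℂ) :
    tensorPower k (Matrix.diagonal z) = Matrix.diagonal fun a => ∏ s, z (a s) := by
  ext a b
  simp only [tensorPower, Matrix.of_apply, Matrix.diagonal_apply, Finset.prod_ite_zero,
    Finset.mem_univ, true_implies, funext_iff]

/-! ### The commutant of the tensor powers and its dimension -/

/-- The operators commuting with `U^{⊗k}` for all unitaries `U`. -/
def commutant (d k : ℕ) : Submodule ℂ (Matrix (Fin k → Fin d) (Fin k → Fin d) ℂ) where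
  carrier := {X | ∀ U : Matrix.unitaryGroup (Fin d) ℂ, Commute (tensorPower k U.1) X}
  add_mem' hX hY U := (hX U).add_right (hY U)
  zero_mem' _ := Commute.zero_right _
  smul_mem' c _ hX U := (hX U).smul_right c

variable {X : Matrix (Fin k → Fin d) (Fin k → Fin d) ℂ}

theorem infinite_unit_sphere_complex : (Metric.sphere (0 : ℂ) 1).Infinite := by
  refine IsPreconnected.infinite_of_nontrivial ?_ ⟨1, by simp, -1, by simp, by norm_num⟩
  exact isPreconnected_sphere (by simp [Complex.rank_real_complex]) 0 1

/-- The unit torus is Zariski dense: where `X a b ≠ 0`, the two monomials agree on it, hence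
everywhere. -/
theorem commute_tensorPower_diagonal (hX : X ∈ commutant d k) (z : Fin d → ℂ) :
    Commute (tensorPower k (Matrix.diagonal z)) X := by
  have key : ∀ a b, X a b ≠ 0 → ∏ s, z (a s) = ∏ s, z (b s) := by
    intro a b hab
    have hp : (∏ s, MvPolynomial.X (a s) : MvPolynomial (Fin d) ℂ) =
        ∏ s, MvPolynomial.X (b s) := by
      refine MvPolynomial.funext_set (fun _ => Metric.sphere (0 : ℂ) 1)
        (fun _ => infinite_unit_sphere_complex) fun x hx => ?_
      have hx' : ∀ i, ‖x i‖ = 1 := fun i => by simpa using hx i trivial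
      have hU : Matrix.diagonal x ∈ Matrix.unitaryGroup (Fin d) ℂ := by
        rw [Matrix.mem_unitaryGroup_iff, Matrix.star_eq_conjTranspose,
          Matrix.diagonal_conjTranspose, Matrix.diagonal_mul_diagonal, ← Matrix.diagonal_one]
        congr 1
        ext i
        simp [Complex.mul_conj, Complex.normSq_eq_norm_sq, hx' i]
      have h := congrFun (congrFun (hX ⟨_, hU⟩).eq a) b
      simp only [tensorPower_diagonal, Matrix.diagonal_mul, Matrix.mul_diagonal] at h
      simp only [map_prod, MvPolynomial.eval_X]
      rw [mul_comm (X a b)] at h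
      exact mul_right_cancel₀ hab h
    simpa using congrArg (MvPolynomial.eval z) hp
  ext a b
  simp only [tensorPower_diagonal, Matrix.diagonal_mul, Matrix.mul_diagonal]
  by_cases hab : X a b = 0
  · simp [hab]
  · rw [key a b hab, mul_comm]

theorem commute_tensorPower_of_isHermitian (hX : X ∈ commutant d k)
    {H : Matrix (Fin d) (Fin d) ℂ} (hH : H.IsHermitian) : Commute (tensorPower k H) X := by
  rw [hH.spectral_theorem, Unitary.conjStarAlgAut_apply, tensorPower_mul, tensorPower_mul]
  refine ((hX _).mul_left (commute_tensorPower_diagonal hX _)).mul_left ?_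
  exact hX (star hH.eigenvectorUnitary)

theorem commute_tensorPower (hX : X ∈ commutant d k) (A : Matrix (Fin d) (Fin d) ℂ) :
    Commute (tensorPower k A) X := by
  obtain ⟨B, C, hB, hC, rfl⟩ : ∃ B C : Matrix (Fin d) (Fin d) ℂ,
      B.IsHermitian ∧ C.IsHermitian ∧ A = B + Complex.I • C :=
    ⟨realPart A, imaginaryPart A, (realPart A).2, (imaginaryPart A).2,
      (realPart_add_I_smul_imaginaryPart A).symm⟩
  ext a b
  -- The `(a, b)` entry of the commutator with `(B + zC)^{⊗k}` is a polynomial in `z`. It vanishes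
  -- for real `z`, where `B + zC` is Hermitian, so also at `z = i`.
  let p : Polynomial ℂ :=
    ∑ c, (∏ s, (Polynomial.C (B (a s) (c s)) + Polynomial.X * Polynomial.C (C (a s) (c s)))) *
        Polynomial.C (X c b) -
      ∑ c, Polynomial.C (X a c) *
        ∏ s, (Polynomial.C (B (c s) (b s)) + Polynomial.X * Polynomial.C (C (c s) (b s)))
  have hp : ∀ z : ℂ, p.eval z =
      (tensorPower k (B + z • C) * X) a b - (X * tensorPower k (B + z • C)) a b := by
    intro z
    simp [p, Polynomial.eval_finsetSum, Polynomial.eval_prod, Matrix.mul_apply, tensorPower,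
      mul_comm z]
  have h0 : p = 0 := by
    refine Polynomial.eq_zero_of_infinite_isRoot p
      ((Set.infinite_range_of_injective Complex.ofReal_injective).mono ?_)
    rintro _ ⟨t, rfl⟩
    have hH : (B + (t : ℂ) • C).IsHermitian := by
      refine hB.add ?_
      rw [Matrix.IsHermitian, Matrix.conjTranspose_smul, hC.eq]
      simp
    change p.eval _ = 0
    rw [hp, (commute_tensorPower_of_isHermitian hX hH).eq, sub_self]
  have := hp Complex.I
  rw [h0, Polynomial.eval_zero] at this
  exact (sub_eq_zero.mp this.symm)

/-- If a homogeneous polynomial function `∑ f, K f * ∏ s, t (f s)` vanishes identically, so does its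
multilinear coefficient. -/
theorem sum_perm_eq_zero_of_forall_sum_eq_zero (K : (Fin k → Fin k) → ℂ)
    (h : ∀ t : Fin k → ℂ, ∑ f, (∏ s, t (f s)) * K f = 0) :
    ∑ σ : Equiv.Perm (Fin k), K σ = 0 := by
  let e : (Fin k → Fin k) → Fin k →₀ ℕ := fun f => ∑ s, Finsupp.single (f s) 1
  have hp : ∑ f, MvPolynomial.monomial (e f) (K f) = (0 : MvPolynomial (Fin k) ℂ) := by
    refine MvPolynomial.funext fun t => ?_
    rw [map_sum, map_zero, ← h t]
    refine Finset.sum_congr rfl fun f _ => ?_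
    rw [← mul_one (K f), ← MvPolynomial.C_mul_monomial]
    simp only [e, MvPolynomial.monomial_sum_one, map_mul, map_prod, MvPolynomial.eval_C]
    simp [mul_comm, ← MvPolynomial.X.eq_1]
  -- `e f` is the exponent of `∏ s, t (f s)`; only bijections `f` contribute to the coefficient of
  -- the squarefree monomial `e id`.
  have he : ∀ f, e f = (e id) ↔ Function.Bijective f := by
    intro f
    have h1 : ∀ (g : Fin k → Fin k) i, e g i = (Finset.univ.filter fun s => g s = i).card := by
      intro g i
      rw [Finset.card_filter, Finsupp.finsetSum_apply]
      exact Finset.sum_congr rfl fun s _ => Finsupp.single_apply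
    constructor
    · intro hf
      rw [← Finite.surjective_iff_bijective]
      intro i
      have h2 : e f i = 1 := by rw [hf, h1]; simp [Finset.filter_eq']
      rw [h1] at h2
      obtain ⟨s, hs⟩ := Finset.card_pos.mp (h2 ▸ Nat.one_pos)
      exact ⟨s, by simpa using hs⟩
    · intro hf
      exact Equiv.sum_comp (Equiv.ofBijective f hf) fun s => Finsupp.single s 1
  have hc := congrArg (MvPolynomial.coeff (e id)) hp
  simp only [MvPolynomial.coeff_sum, MvPolynomial.coeff_monomial, he, MvPolynomial.coeff_zero]
    at hc
  classical
  rw [← Finset.sum_filter] at hc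
  rw [← hc]
  refine Finset.sum_bij (fun σ _ => ⇑σ) (fun σ _ => ?_)
    (fun σ _ τ _ h => Equiv.coe_fn_injective h) (fun f hf => ?_) fun _ _ => rfl
  · exact Finset.mem_filter.mpr ⟨Finset.mem_univ _, σ.bijective⟩
  · exact ⟨Equiv.ofBijective f (Finset.mem_filter.mp hf).2, Finset.mem_univ _, rfl⟩

/-- The symmetrized matrix units, spanning the symmetric subspace of `(M_d)^{⊗k}`. -/
def symUnit (i j : Fin k → Fin d) : Matrix (Fin k → Fin d) (Fin k → Fin d) ℂ :=
  ∑ σ : Equiv.Perm (Fin k), Matrix.single (i ∘ σ) (j ∘ σ) 1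

theorem tensorPower_sum_single (i j : Fin k → Fin d) (t : Fin k → ℂ) :
    tensorPower k (∑ s, t s • Matrix.single (i s) (j s) (1 : ℂ)) =
      ∑ f : Fin k → Fin k, (∏ s, t (f s)) • Matrix.single (i ∘ f) (j ∘ f) (1 : ℂ) := by
  ext a b
  simp only [tensorPower, Matrix.of_apply, Matrix.sum_apply, Matrix.smul_apply,
    Finset.prod_univ_sum, Fintype.piFinset_univ, smul_eq_mul, Finset.prod_mul_distrib]
  refine Finset.sum_congr rfl fun f _ => ?_
  congr 1
  simp only [Matrix.single_apply, Finset.prod_ite_zero, Finset.prod_const_one, Finset.mem_univ,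
    true_implies, funext_iff, Function.comp_apply, forall_and]

/-- Polarization: up to order, `symUnit i j` is the multilinear coefficient in `t` of the tensor
power of `∑ t_s E_{i_s j_s}`. -/
theorem commute_symUnit (hX : X ∈ commutant d k) (i j : Fin k → Fin d) :
    Commute (symUnit i j) X := by
  ext a b
  let K : (Fin k → Fin k) → ℂ := fun f =>
    (Matrix.single (i ∘ f) (j ∘ f) (1 : ℂ) * X - X * Matrix.single (i ∘ f) (j ∘ f) (1 : ℂ)) a b
  have hK := sum_perm_eq_zero_of_forall_sum_eq_zero K fun t => by
    have h := sub_eq_zero.mpr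
      (commute_tensorPower hX (∑ s, t s • Matrix.single (i s) (j s) (1 : ℂ))).eq
    rw [tensorPower_sum_single, Finset.sum_mul, Finset.mul_sum, ← Finset.sum_sub_distrib] at h
    have h' := congrFun (congrFun h a) b
    rw [Matrix.sum_apply] at h'
    simpa only [K, smul_mul_assoc, mul_smul_comm, ← smul_sub, Matrix.smul_apply, smul_eq_mul,
      Matrix.zero_apply]
      using h'
  rw [← sub_eq_zero, ← Matrix.sub_apply, symUnit, Finset.sum_mul, Finset.mul_sum,
    ← Finset.sum_sub_distrib, Matrix.sum_apply]
  exact hK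

theorem symUnit_conjTranspose (i j : Fin k → Fin d) : (symUnit i j)ᴴ = symUnit j i := by
  simp [symUnit, Matrix.conjTranspose_sum, Matrix.conjTranspose_single]

theorem sum_symUnit_self :
    ∑ j : Fin k → Fin d, symUnit j j =
      (k.factorial : ℂ) • (1 : Matrix (Fin k → Fin d) (Fin k → Fin d) ℂ) := by
  have h1 : ∀ σ : Equiv.Perm (Fin k), ∑ j : Fin k → Fin d,
      Matrix.single (j ∘ σ) (j ∘ σ) (1 : ℂ) = 1 := by
    intro σ
    exact ((σ.symm.arrowCongr (Equiv.refl (Fin d))).sum_comp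
      fun j : Fin k → Fin d => Matrix.single j j (1 : ℂ)).trans Matrix.sum_single_one
  simp only [symUnit]
  rw [Finset.sum_comm, Finset.sum_congr rfl fun σ _ => h1 σ]
  simp [Fintype.card_perm, Nat.cast_smul_eq_nsmul]

theorem sum_symUnit_mul_mul (hX : ∀ σ : Equiv.Perm (Fin k), ∑ a, X a (a ∘ σ) = 0) :
    ∑ i, ∑ j, symUnit i j * X * symUnit j i = 0 := by
  have h1 : ∀ (σ τ : Equiv.Perm (Fin k)), ∑ j : Fin k → Fin d, X (j ∘ σ) (j ∘ τ) = 0 := by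
    intro σ τ
    -- Substituting `a = j ∘ σ` turns `j ∘ τ` into `a ∘ σ⁻¹ ∘ τ`.
    rw [← hX (τ.trans σ.symm)]
    refine Fintype.sum_equiv (σ.symm.arrowCongr (Equiv.refl (Fin d))) _ _ fun j => ?_
    congr 1
    ext s
    simp [Equiv.arrowCongr]
  refine Finset.sum_eq_zero fun i _ => ?_
  simp only [symUnit, Finset.sum_mul, Finset.mul_sum, Matrix.single_mul_mul_single, one_mul, mul_one]
  rw [Finset.sum_comm]
  refine Finset.sum_eq_zero fun σ _ => ?_
  rw [Finset.sum_comm]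
  refine Finset.sum_eq_zero fun τ _ => ?_
  ext a b
  simp only [Matrix.sum_apply, Matrix.single_apply]
  split_ifs <;> simp [h1]

-- Moving `X` past the symmetrized units makes the trace of `Xᴴ` times the vanishing sum a sum of
-- squared Hilbert-Schmidt norms. Every `symUnit j i * X` is then zero, and the diagonal units add
-- up to `k!` times the identity.
open scoped ComplexOrder in
theorem eq_zero_of_mem_commutant (hX : X ∈ commutant d k)
    (h : ∀ σ : Equiv.Perm (Fin k), ∑ a, X a (a ∘ σ) = 0) : X = 0 := by
  have h1 : ∑ i, ∑ j, ((symUnit j i * X)ᴴ * (symUnit j i * X)).trace = 0 := by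
    have h2 := congrArg (fun Y => (Xᴴ * Y).trace) (sum_symUnit_mul_mul h)
    simp only [Finset.mul_sum, Matrix.trace_sum, mul_zero, Matrix.trace_zero] at h2
    rw [← h2]
    refine Finset.sum_congr rfl fun i _ => Finset.sum_congr rfl fun j _ => ?_
    rw [mul_assoc (symUnit i j), ← (commute_symUnit hX j i).eq, Matrix.conjTranspose_mul,
      symUnit_conjTranspose, mul_assoc]
  have h0 : ∀ i j : Fin k → Fin d, 0 ≤ ((symUnit j i * X)ᴴ * (symUnit j i * X)).trace :=
    fun i j => (Matrix.posSemidef_conjTranspose_mul_self _).trace_nonneg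
  have h3 : ∀ j : Fin k → Fin d, symUnit j j * X = 0 := by
    intro j
    have h4 := (Finset.sum_eq_zero_iff_of_nonneg
      fun i _ => Finset.sum_nonneg fun j _ => h0 i j).mp h1 j (Finset.mem_univ _)
    have h5 := (Finset.sum_eq_zero_iff_of_nonneg fun l _ => h0 j l).mp h4 j (Finset.mem_univ _)
    exact Matrix.trace_conjTranspose_mul_self_eq_zero_iff.mp h5
  have h6 : (k.factorial : ℂ) • X = 0 := by
    rw [← one_mul X, ← smul_mul_assoc, ← sum_symUnit_self, Finset.sum_mul]
    exact Finset.sum_eq_zero fun j _ => h3 j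
  exact (smul_eq_zero.mp h6).resolve_left (Nat.cast_ne_zero.mpr k.factorial_ne_zero)

theorem finrank_commutant_le (d k : ℕ) : Module.finrank ℂ (commutant d k) ≤ k.factorial := by
  let L : commutant d k →ₗ[ℂ] Equiv.Perm (Fin k) → ℂ :=
    { toFun := fun X σ => ∑ a, X.1 a (a ∘ σ)
      map_add' := fun X Y => by ext σ; simp [Finset.sum_add_distrib]
      map_smul' := fun c X => by ext σ; simp [Finset.mul_sum] }
  have hL : Function.Injective L := by
    rw [← LinearMap.ker_eq_bot, LinearMap.ker_eq_bot']
    exact fun X hX => Subtype.ext (eq_zero_of_mem_commutant X.2 fun σ => congrFun hX σ)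
  simpa [Fintype.card_perm] using LinearMap.finrank_le_finrank_of_injective hL


/-! ### Trace norm estimates and the diamond norm as an upper bound -/

section TraceNorm

variable {n : Type*} [Fintype n] [DecidableEq n]

theorem traceNorm_nonneg (X : Matrix n n ℂ) : 0 ≤ traceNorm X :=
  Finset.sum_nonneg fun _ _ => Real.sqrt_nonneg _

theorem eigenvalues_le_traceNorm_sq (X : Matrix n n ℂ) (i : n) :
    (Matrix.isHermitian_conjTranspose_mul_self X).eigenvalues i ≤ traceNorm X ^ 2 := by
  have h0 : 0 ≤ (Matrix.isHermitian_conjTranspose_mul_self X).eigenvalues i :=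
    Matrix.eigenvalues_conjTranspose_mul_self_nonneg X i
  rw [← Real.sqrt_le_left (traceNorm_nonneg X)]
  exact Finset.single_le_sum
    (f := fun i => √((Matrix.isHermitian_conjTranspose_mul_self X).eigenvalues i))
    (fun _ _ => Real.sqrt_nonneg _) (Finset.mem_univ i)

open scoped ComplexOrder in
theorem posSemidef_traceNorm_sq_sub (X : Matrix n n ℂ) :
    (((traceNorm X ^ 2 : ℝ) : ℂ) • (1 : Matrix n n ℂ) - Xᴴ * X).PosSemidef := by
  have hM := Matrix.isHermitian_conjTranspose_mul_self X
  let U : Matrix n n ℂ := hM.eigenvectorUnitary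
  have hU : U * Uᴴ = 1 := Matrix.mem_unitaryGroup_iff.mp hM.eigenvectorUnitary.2
  have hd : (Matrix.diagonal fun i =>
      ((traceNorm X ^ 2 - hM.eigenvalues i : ℝ) : ℂ)).PosSemidef :=
    Matrix.PosSemidef.diagonal fun i => by
      simpa using Complex.zero_le_real.mpr (sub_nonneg.mpr (eigenvalues_le_traceNorm_sq X i))
  convert hd.mul_mul_conjTranspose_same U using 1
  have h2 : Xᴴ * X = U * Matrix.diagonal (fun i => (hM.eigenvalues i : ℂ)) * Uᴴ :=
    hM.spectral_theorem
  have h3 : (Matrix.diagonal fun i => ((traceNorm X ^ 2 - hM.eigenvalues i : ℝ) : ℂ)) =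
      ((traceNorm X ^ 2 : ℝ) : ℂ) • 1 - Matrix.diagonal fun i => (hM.eigenvalues i : ℂ) := by
    rw [Matrix.smul_one_eq_diagonal, Matrix.diagonal_sub]
    congr 1
    ext i
    push_cast
    rfl
  rw [h3, mul_sub, sub_mul, ← h2, mul_smul_comm, mul_one, smul_mul_assoc, hU]

theorem norm_mulVec_le_traceNorm (X : Matrix n n ℂ) (φ : EuclideanSpace ℂ n) (hφ : ‖φ‖ = 1) :
    ‖WithLp.toLp 2 (X *ᵥ φ.ofLp)‖ ≤ traceNorm X := by
  have h := (posSemidef_traceNorm_sq_sub X).re_dotProduct_nonneg φ.ofLp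
  have h1 : ∀ ψ : EuclideanSpace ℂ n, RCLike.re (star ψ.ofLp ⬝ᵥ ψ.ofLp) = ‖ψ‖ ^ 2 := by
    intro ψ
    rw [← inner_self_eq_norm_sq (𝕜 := ℂ), EuclideanSpace.inner_eq_star_dotProduct,
      dotProduct_comm]
  have h2 := h1 (WithLp.toLp 2 (X *ᵥ φ.ofLp))
  rw [Matrix.sub_mulVec, dotProduct_sub, Matrix.smul_mulVec, Matrix.one_mulVec, dotProduct_smul,
    ← Matrix.mulVec_mulVec, Matrix.dotProduct_mulVec, ← Matrix.star_mulVec, map_sub, h2,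
    smul_eq_mul, RCLike.re_eq_complex_re, Complex.re_ofReal_mul, ← RCLike.re_eq_complex_re, h1, hφ]
    at h
  exact abs_le_of_sq_le_sq' (by linarith) (traceNorm_nonneg X) |>.2

theorem norm_dotProduct_mulVec_le_traceNorm (X : Matrix n n ℂ) (φ : EuclideanSpace ℂ n)
    (hφ : ‖φ‖ = 1) : ‖star φ.ofLp ⬝ᵥ (X *ᵥ φ.ofLp)‖ ≤ traceNorm X := by
  have h := norm_inner_le_norm (𝕜 := ℂ) φ (WithLp.toLp 2 (X *ᵥ φ.ofLp))
  rw [EuclideanSpace.inner_eq_star_dotProduct, dotProduct_comm, hφ, one_mul] at h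
  exact h.trans (norm_mulVec_le_traceNorm X φ hφ)

/-- A crude bound from `√x ≤ 1 + x`, useful because its right side is visibly continuous in `X`. -/
theorem traceNorm_le (X : Matrix n n ℂ) :
    traceNorm X ≤ Fintype.card n + ∑ i, ∑ j, ‖X j i‖ ^ 2 := by
  have hM := Matrix.isHermitian_conjTranspose_mul_self X
  have h1 : ∑ i, hM.eigenvalues i = ∑ i, ∑ j, ‖X j i‖ ^ 2 := by
    have h := hM.trace_eq_sum_eigenvalues
    have h' : (Xᴴ * X).trace = ((∑ i, ∑ j, ‖X j i‖ ^ 2 : ℝ) : ℂ) := by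
      simp only [Matrix.trace, Matrix.diag_apply, Matrix.mul_apply, Matrix.conjTranspose_apply]
      push_cast
      exact Finset.sum_congr rfl fun i _ => Finset.sum_congr rfl fun j _ => Complex.conj_mul' _
    rw [h', ← RCLike.ofReal_sum] at h
    exact Complex.ofReal_injective h.symm
  rw [← h1, traceNorm]
  calc ∑ i, √(hM.eigenvalues i) ≤ ∑ i, (1 + hM.eigenvalues i) :=
        Finset.sum_le_sum fun i _ => by
          have h0 : 0 ≤ hM.eigenvalues i := Matrix.eigenvalues_conjTranspose_mul_self_nonneg X i
          nlinarith [Real.sq_sqrt h0, sq_nonneg (√(hM.eigenvalues i) - 1)]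
    _ = _ := by simp [Finset.sum_add_distrib]

omit [DecidableEq n] in
theorem continuous_tensorId_ketbra (Φ : Matrix n n ℂ →ₗ[ℂ] Matrix n n ℂ) (a b : n × n) :
    Continuous fun ψ : EuclideanSpace ℂ (n × n) => tensorId n Φ (ketbra ψ) a b := by
  have h1 : Continuous fun ψ : EuclideanSpace ℂ (n × n) =>
      (Matrix.of fun i j => ketbra ψ (i, a.2) (j, b.2) : Matrix n n ℂ) := by
    refine continuous_matrix fun i j => ?_
    simp only [ketbra, Matrix.of_apply]
    fun_prop
  exact ((Φ.continuous_of_finiteDimensional.comp h1).matrix_elem a.1 b.1)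

theorem traceNorm_tensorId_le_diamondNorm (Φ : Matrix n n ℂ →ₗ[ℂ] Matrix n n ℂ)
    (ψ : EuclideanSpace ℂ (n × n)) (hψ : ‖ψ‖ = 1) :
    traceNorm (tensorId n Φ (ketbra ψ)) ≤ diamondNorm Φ := by
  have hc : Continuous fun ψ : EuclideanSpace ℂ (n × n) =>
      (Fintype.card (n × n) : ℝ) + ∑ i, ∑ j, ‖tensorId n Φ (ketbra ψ) j i‖ ^ 2 :=
    continuous_const.add (continuous_finsetSum _ fun i _ => continuous_finsetSum _ fun j _ =>
      (continuous_tensorId_ketbra Φ j i).norm.pow 2)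
  -- A real `⨆` over an unbounded family would be `0`; compactness of the sphere excludes this.
  obtain ⟨C, hC⟩ := ((isCompact_sphere (0 : EuclideanSpace ℂ (n × n)) 1).image hc).bddAbove
  refine le_ciSup (f := fun ψ : {ψ : EuclideanSpace ℂ (n × n) // ‖ψ‖ = 1} =>
    traceNorm (tensorId n Φ (ketbra ψ.1))) ⟨C, ?_⟩ ⟨ψ, hψ⟩
  rintro _ ⟨χ, rfl⟩
  exact (traceNorm_le _).trans (hC ⟨χ.1, by simpa using χ.2, rfl⟩)

/-! ### The entanglement fidelity with a maximally entangled state -/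

theorem trace_eq_sum_single (Φ : Matrix n n ℂ →ₗ[ℂ] Matrix n n ℂ) :
    LinearMap.trace ℂ _ Φ = ∑ i, ∑ j, Φ (Matrix.single i j 1) i j := by
  rw [LinearMap.trace_eq_matrix_trace ℂ (Matrix.stdBasis ℂ n n), Matrix.trace,
    Fintype.sum_prod_type]
  refine Finset.sum_congr rfl fun i _ => Finset.sum_congr rfl fun j _ => ?_
  rw [Matrix.diag_apply, LinearMap.toMatrix_apply, Matrix.stdBasis_eq_single]
  rfl

/-- The map `X ↦ A X B`. -/
def sandwich (A B : Matrix n n ℂ) : Matrix n n ℂ →ₗ[ℂ] Matrix n n ℂ :=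
  LinearMap.mulLeft ℂ A ∘ₗ LinearMap.mulRight ℂ B

theorem sandwich_apply (A B X : Matrix n n ℂ) : sandwich A B X = A * X * B :=
  (mul_assoc A X B).symm

theorem trace_sandwich (A B : Matrix n n ℂ) :
    LinearMap.trace ℂ _ (sandwich A B) = A.trace * B.trace := by
  rw [trace_eq_sum_single, Matrix.trace, Matrix.trace, Finset.sum_mul_sum]
  refine Finset.sum_congr rfl fun i _ => Finset.sum_congr rfl fun j _ => ?_
  rw [sandwich_apply, Matrix.mul_apply, Finset.sum_eq_single j]
  · simp
  · intro l _ hl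
    simp [Matrix.mul_apply, hl.symm]
  · simp

/-- The maximally entangled vector with coefficient matrix proportional to `V`. -/
def maxEntangled (V : Matrix n n ℂ) : EuclideanSpace ℂ (n × n) :=
  WithLp.toLp 2 fun p => ((√(Fintype.card n))⁻¹ : ℝ) * V p.1 p.2

theorem norm_maxEntangled [Nonempty n] {V : Matrix n n ℂ} (hV : Vᴴ * V = 1) :
    ‖maxEntangled V‖ = 1 := by
  have hV' : ∀ j, ∑ i, ‖V i j‖ ^ 2 = 1 := by
    intro j
    have h := congrFun (congrFun hV j) j
    simp only [Matrix.mul_apply, Matrix.conjTranspose_apply, Matrix.one_apply_eq] at h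
    have h' : ((∑ i, ‖V i j‖ ^ 2 : ℝ) : ℂ) = 1 := by
      rw [← h]
      push_cast
      exact Finset.sum_congr rfl fun i _ => (Complex.conj_mul' _).symm
    exact_mod_cast h'
  have hc : (Fintype.card n : ℝ) ≠ 0 := by positivity
  have : ‖maxEntangled V‖ ^ 2 = 1 := by
    rw [EuclideanSpace.norm_sq_eq, Fintype.sum_prod_type_right]
    simp only [maxEntangled, norm_mul, mul_pow, ← Finset.mul_sum, hV', Complex.norm_real]
    simp [hc]
  exact (pow_eq_one_iff_of_nonneg (norm_nonneg _) two_ne_zero).mp this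

theorem inv_sqrt_card_mul_self (n : Type*) [Fintype n] :
    (((√(Fintype.card n))⁻¹ : ℝ) : ℂ) * ((√(Fintype.card n))⁻¹ : ℝ) = (Fintype.card n : ℂ)⁻¹ := by
  rw [← Complex.ofReal_mul, ← mul_inv, Real.mul_self_sqrt (Nat.cast_nonneg _)]
  push_cast
  rfl

theorem tensorId_ketbra_maxEntangled (Φ : Matrix n n ℂ →ₗ[ℂ] Matrix n n ℂ) (a b : n × n) :
    tensorId n Φ (ketbra (maxEntangled 1)) a b =
      (Fintype.card n : ℂ)⁻¹ * Φ (Matrix.single a.2 b.2 1) a.1 b.1 := by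
  have h : (Matrix.of fun i j => ketbra (maxEntangled (1 : Matrix n n ℂ)) (i, a.2) (j, b.2)) =
      (Fintype.card n : ℂ)⁻¹ • Matrix.single a.2 b.2 (1 : ℂ) := by
    ext i j
    rw [Matrix.smul_apply, ← inv_sqrt_card_mul_self]
    by_cases h1 : i = a.2 <;> by_cases h2 : j = b.2 <;>
      simp [ketbra, maxEntangled, Matrix.one_apply, h1, h2, eq_comm]
  rw [tensorId, Matrix.of_apply, h, map_smul, Matrix.smul_apply, smul_eq_mul]

theorem dotProduct_tensorId_maxEntangled (Φ : Matrix n n ℂ →ₗ[ℂ] Matrix n n ℂ)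
    (V : Matrix n n ℂ) :
    star (maxEntangled V).ofLp ⬝ᵥ
        (tensorId n Φ (ketbra (maxEntangled 1)) *ᵥ (maxEntangled V).ofLp) =
      ((Fintype.card n : ℂ) ^ 2)⁻¹ * LinearMap.trace ℂ _ (sandwich Vᴴ V ∘ₗ Φ) := by
  rw [trace_eq_sum_single]
  simp only [dotProduct, Matrix.mulVec, LinearMap.comp_apply, sandwich_apply, Matrix.mul_apply,
    Matrix.conjTranspose_apply, Fintype.sum_prod_type, Pi.star_apply, Finset.mul_sum,
    Finset.sum_mul]
  rw [Finset.sum_comm]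
  refine Finset.sum_congr rfl fun a' _ => ?_
  rw [Finset.sum_comm]
  refine (Finset.sum_congr rfl fun b _ => Finset.sum_comm).trans (Finset.sum_comm.trans ?_)
  refine Finset.sum_congr rfl fun b' _ => Finset.sum_congr rfl fun b _ =>
    Finset.sum_congr rfl fun a _ => ?_
  rw [tensorId_ketbra_maxEntangled, pow_two, mul_inv]
  nth_rewrite 2 [← inv_sqrt_card_mul_self]
  simp only [maxEntangled, star_mul', Complex.star_def, Complex.conj_ofReal]
  ring

end TraceNorm


/-! ### The Haar twirl as the projection onto the commutant -/

theorem tensorPower_conjTranspose_mul_self (k : ℕ) (U : Matrix.unitaryGroup (Fin d) ℂ) :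
    (tensorPower k U.1)ᴴ * tensorPower k U.1 = 1 := by
  rw [← tensorPower_conjTranspose, ← tensorPower_mul, ← Matrix.star_eq_conjTranspose,
    Matrix.mem_unitaryGroup_iff'.mp U.2, tensorPower_one]

theorem tensorPower_mul_conjTranspose_self (k : ℕ) (U : Matrix.unitaryGroup (Fin d) ℂ) :
    tensorPower k U.1 * (tensorPower k U.1)ᴴ = 1 := by
  rw [← tensorPower_conjTranspose, ← tensorPower_mul, ← Matrix.star_eq_conjTranspose,
    Matrix.mem_unitaryGroup_iff.mp U.2, tensorPower_one]

theorem conjChannel_apply (U : Matrix.unitaryGroup (Fin d) ℂ)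
    (X : Matrix (Fin k → Fin d) (Fin k → Fin d) ℂ) :
    conjChannel k U X = tensorPower k U.1 * X * (tensorPower k U.1)ᴴ := by
  rw [← tensorPower_conjTranspose]
  rfl

theorem conjChannel_mul (U V : Matrix.unitaryGroup (Fin d) ℂ)
    (X : Matrix (Fin k → Fin d) (Fin k → Fin d) ℂ) :
    conjChannel k (U * V) X = conjChannel k U (conjChannel k V X) := by
  simp only [conjChannel_apply, Submonoid.coe_mul, tensorPower_mul, Matrix.conjTranspose_mul,
    mul_assoc]

theorem conjChannel_haarTwirl (U : Matrix.unitaryGroup (Fin d) ℂ)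
    (X : Matrix (Fin k → Fin d) (Fin k → Fin d) ℂ) :
    conjChannel k U (haarTwirl d k X) = haarTwirl d k X := by
  ext a b
  have h1 : haarTwirl d k X a b = ∫ V, conjChannel k (U * V) X a b ∂(haar d) :=
    (integral_mul_left_eq_self (fun V => conjChannel k V X a b) U).symm
  rw [h1]
  simp only [conjChannel_mul]
  simp only [conjChannel_apply U, Matrix.mul_apply]
  rw [integral_finsetSum _ fun c _ => Integrable.mul_const (integrable_finsetSum _ fun e _ =>
    (integrable_conjChannel_apply k X e c).const_mul _) _]
  refine Finset.sum_congr rfl fun c _ => ?_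
  rw [integral_mul_const, integral_finsetSum _ fun e _ =>
    (integrable_conjChannel_apply k X e c).const_mul _]
  simp only [integral_const_mul]
  rfl

theorem mem_commutant_iff {X : Matrix (Fin k → Fin d) (Fin k → Fin d) ℂ} :
    X ∈ commutant d k ↔ ∀ U, conjChannel k U X = X := by
  refine forall_congr' fun U => ?_
  rw [conjChannel_apply]
  constructor
  · intro h
    rw [h.eq, mul_assoc, tensorPower_mul_conjTranspose_self, mul_one]
  · intro h
    change tensorPower k U.1 * X = X * tensorPower k U.1
    conv_rhs => rw [← h]
    rw [mul_assoc, tensorPower_conjTranspose_mul_self, mul_one]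

theorem isProj_haarTwirl (d k : ℕ) : LinearMap.IsProj (commutant d k) (haarTwirl d k) where
  map_mem X := mem_commutant_iff.mpr fun U => conjChannel_haarTwirl U X
  map_id X hX := by
    ext a b
    change ∫ U, conjChannel k U X a b ∂(haar d) = X a b
    simp [mem_commutant_iff.mp hX]

theorem trace_haarTwirl (d k : ℕ) :
    LinearMap.trace ℂ _ (haarTwirl d k) = Module.finrank ℂ (commutant d k) :=
  (isProj_haarTwirl d k).trace

/-- Conjugation fixes the range of the twirl, so the Haar contribution does not depend on the tested
unitary. -/
theorem sandwich_comp_haarTwirl (U : Matrix.unitaryGroup (Fin d) ℂ) :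
    sandwich (tensorPower k U.1)ᴴ (tensorPower k U.1) ∘ₗ haarTwirl d k = haarTwirl d k := by
  refine LinearMap.ext fun X => ?_
  have h := mem_commutant_iff.mp ((isProj_haarTwirl d k).map_mem X) U
  rw [LinearMap.comp_apply, sandwich_apply]
  conv_lhs => rw [← h, conjChannel_apply]
  rw [← mul_assoc, ← mul_assoc, tensorPower_conjTranspose_mul_self, one_mul, mul_assoc,
    tensorPower_conjTranspose_mul_self, mul_one]

theorem trace_sandwich_comp_conjChannel (U V : Matrix.unitaryGroup (Fin d) ℂ) :
    LinearMap.trace ℂ _ (sandwich (tensorPower k U.1)ᴴ (tensorPower k U.1) ∘ₗ conjChannel k V) =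
      ((‖((tensorPower k U.1)ᴴ * tensorPower k V.1).trace‖ ^ 2 : ℝ) : ℂ) := by
  have h : sandwich (tensorPower k U.1)ᴴ (tensorPower k U.1) ∘ₗ conjChannel k V =
      sandwich ((tensorPower k U.1)ᴴ * tensorPower k V.1)
        ((tensorPower k U.1)ᴴ * tensorPower k V.1)ᴴ := by
    refine LinearMap.ext fun X => ?_
    simp only [LinearMap.comp_apply, sandwich_apply, conjChannel_apply, Matrix.conjTranspose_mul,
      Matrix.conjTranspose_conjTranspose, mul_assoc]
  rw [h, trace_sandwich, Matrix.trace_conjTranspose, Complex.star_def, Complex.mul_conj']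
  push_cast
  rfl

/-! ### The bound on the weights -/

variable {N : ℕ}

theorem Ensemble.p_mul_le_re_trace (E : Ensemble d N) (k : ℕ) (j : Fin N) :
    E.p j * (d : ℝ) ^ (2 * k) ≤ (LinearMap.trace ℂ _
      (sandwich (tensorPower k (E.U j).1)ᴴ (tensorPower k (E.U j).1) ∘ₗ E.twirl k)).re := by
  have hsum : ∀ S : Matrix (Fin k → Fin d) (Fin k → Fin d) ℂ →ₗ[ℂ]
      Matrix (Fin k → Fin d) (Fin k → Fin d) ℂ,
      S ∘ₗ E.twirl k = ∑ i, S ∘ₗ ((E.p i : ℂ) • conjChannel k (E.U i)) := fun S =>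
    LinearMap.ext fun X => by simp [Ensemble.twirl]
  rw [hsum, map_sum]
  simp only [LinearMap.comp_smul, map_smul, trace_sandwich_comp_conjChannel, smul_eq_mul,
    ← Complex.ofReal_mul, ← Complex.ofReal_sum, Complex.ofReal_re]
  -- Only the term `i = j` is kept; there the trace is that of the identity, `d^k`.
  refine le_trans (le_of_eq ?_) (Finset.single_le_sum (fun i _ =>
    mul_nonneg (E.p_nonneg i) (sq_nonneg _)) (Finset.mem_univ j))
  rw [tensorPower_conjTranspose_mul_self]
  simp [pow_mul, pow_right_comm _ 2 k]

theorem Ensemble.IsApproxDesign.p_le {E : Ensemble d N} {k : ℕ} {ε : ℝ} (hd : 1 ≤ d)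
    (hE : E.IsApproxDesign k ε) (j : Fin N) :
    E.p j ≤ (1 + ε) * ((k.factorial : ℝ) / (d : ℝ) ^ (2 * k)) := by
  have : Nonempty (Fin d) := ⟨⟨0, hd⟩⟩
  set V := tensorPower k (E.U j).1
  set Δ := E.twirl k - haarTwirl d k with hΔ
  have hV : Vᴴ * V = 1 := tensorPower_conjTranspose_mul_self k (E.U j)
  have h1 : ‖maxEntangled (1 : Matrix (Fin k → Fin d) (Fin k → Fin d) ℂ)‖ = 1 :=
    norm_maxEntangled (by simp)
  have hD : (0 : ℝ) < (d : ℝ) ^ (2 * k) := by positivity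
  have hcard : ((Fintype.card (Fin k → Fin d) : ℂ) ^ 2)⁻¹ =
      ((((d : ℝ) ^ (2 * k))⁻¹ : ℝ) : ℂ) := by
    simp [pow_mul, pow_right_comm _ 2 k]
  have h2 := ((Complex.re_le_norm _).trans
    (norm_dotProduct_mulVec_le_traceNorm (tensorId _ Δ (ketbra (maxEntangled 1)))
      (maxEntangled V) (norm_maxEntangled hV))).trans
    ((traceNorm_tensorId_le_diamondNorm Δ _ h1).trans hE)
  rw [dotProduct_tensorId_maxEntangled, hcard, Complex.re_ofReal_mul, hΔ, LinearMap.comp_sub,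
    map_sub, sandwich_comp_haarTwirl, trace_haarTwirl, Complex.sub_re, Complex.natCast_re] at h2
  have h3 := E.p_mul_le_re_trace k j
  have h4 : (Module.finrank ℂ (commutant d k) : ℝ) ≤ k.factorial :=
    Nat.cast_le.mpr (finrank_commutant_le d k)
  rw [inv_mul_le_iff₀ hD] at h2
  rw [← mul_div_assoc, le_div_iff₀ hD]
  have h5 : (d : ℝ) ^ (2 * k) * ((k.factorial : ℝ) / (d : ℝ) ^ (2 * k) * ε) =
      k.factorial * ε := by
    field_simp
  linarith

end UnitaryDesign

end

theorem mainTheorem3 (d k N : ℕ) (hd : 1 ≤ d) (ε : ℝ) (hε : 0 < ε)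
    (E : UnitaryDesign.Ensemble d N) (hE : E.IsApproxDesign k ε) :
    (∀ j : Fin N, E.p j ≤ (1 + ε) * ((k.factorial : ℝ) / (d : ℝ) ^ (2 * k))) ∧
      (d : ℝ) ^ (2 * k) / ((1 + ε) * (k.factorial : ℝ)) ≤ (N : ℝ) := by
  refine ⟨hE.p_le hd, ?_⟩
  have hd' : (0 : ℝ) < d := by exact_mod_cast hd
  -- The weights sum to one, so adding the `N` equal bounds yields the bound on `N`.
  have h := Finset.sum_le_sum fun j (_ : j ∈ Finset.univ) => hE.p_le hd j
  rw [E.sum_p, Finset.sum_const, Finset.card_univ, Fintype.card_fin, nsmul_eq_mul,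
    ← mul_div_assoc, ← mul_div_assoc, le_div_iff₀ (by positivity), one_mul] at h
  rwa [div_le_iff₀ (by positivity)]
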